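/- There are $n$ prisoners and $r$ rooms, and each room has $s$ lightswitches. At each time $t=0,1,2,\dots$ the warden leads one prisoner into one room. The rooms are indistinguishable except for the configurations (on/off positions) of their switches. The visiting prisoner sees the current configuration of the room, may change it arbitrarily, and may declare. A (deterministic) strategy prescribes, for each prisoner, the configuration in which he leaves the room and whether he declares, as a function only of the sequence of configurations he has found on his visits so far, including the current one (there is no clock and no other communication). A schedule of visits is valid if it leads each prisoner into each room infinitely often. For given starting configurations of the rooms, a strategy is winning if under every valid schedule some prisoner eventually declares and, at the time of the first declaration, each prisoner has visited every room at least once. The strategy may be chosen with knowledge of the starting configurations. Theorem. Let $s=1$, $n\ge 2$ and $r\ge 5$. Then, for every choice of starting configurations of the $r$ rooms, there is no winning strategy. In particular, there is no winning strategy when every switch starts off. -/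

import Mathlib

open Filter

namespace Prisoners

/-- A configuration of a room with `s` switches: `true` is on and `false` is off. -/
abbrev Config (s : ℕ) : Type := Fin s → Bool

/-- A (deterministic) strategy for `n` prisoners when each room has `s` switches.
Rooms are indistinguishable, so what a prisoner does on a visit depends only on who he is, on the
configurations he found on his earlier visits (a list, the most recent first) and on the
configuration he finds now.  He has no clock and learns nothing about the visits of the others. -/
structure Strategy (n s : ℕ) where
  /-- the configuration in which the prisoner leaves the room -/
  reconfigure : Fin n → List (Config s) → Config s → Config s
  /-- whether the prisoner declares on this visit -/
  declares : Fin n → List (Config s) → Config s → Prop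

/-- A schedule: at time `t` the warden leads prisoner `(σ t).1` into room `(σ t).2`. -/
abbrev Schedule (n r : ℕ) : Type := ℕ → Fin n × Fin r

/-- A schedule is valid if it leads each prisoner into each room infinitely often. -/
def Schedule.IsValid {n r : ℕ} (σ : Schedule n r) : Prop :=
  ∀ (p : Fin n) (x : Fin r), ∃ᶠ t in atTop, σ t = (p, x)

/-- The state of the prison: the configuration of each room, and the list of configurations that
each prisoner has found so far, the most recent first. -/
structure State (n r s : ℕ) where
  config : Fin r → Config s
  seen : Fin n → List (Config s)

namespace Strategy

variable {n r s : ℕ}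

/-- The effect of a visit of prisoner `v.1` to room `v.2`. -/
def step (S : Strategy n s) (st : State n r s) (v : Fin n × Fin r) : State n r s where
  config := Function.update st.config v.2
    (S.reconfigure v.1 (st.seen v.1) (st.config v.2))
  seen := Function.update st.seen v.1 (st.config v.2 :: st.seen v.1)

/-- The state just before the visit at time `t`, when the rooms start in configuration `start`. -/
def stateAt (S : Strategy n s) (start : Fin r → Config s) (σ : Schedule n r) : ℕ → State n r s
  | 0 => { config := start, seen := fun _ => [] }
  | t + 1 => S.step (S.stateAt start σ t) (σ t)

/-- The visiting prisoner declares on the visit at time `t`. -/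
def DeclaresAt (S : Strategy n s) (start : Fin r → Config s) (σ : Schedule n r) (t : ℕ) : Prop :=
  S.declares (σ t).1 ((S.stateAt start σ t).seen (σ t).1)
    ((S.stateAt start σ t).config (σ t).2)

/-- A strategy is winning for the starting configurations `start` if, under every valid schedule,
some prisoner eventually declares, and at the first declaration each prisoner has visited every
room at least once (the visit on which the declaration is made counts). -/
def IsWinning (S : Strategy n s) (start : Fin r → Config s) : Prop :=
  ∀ σ : Schedule n r, σ.IsValid →
    ∃ t : ℕ, S.DeclaresAt start σ t ∧ (∀ t' < t, ¬ S.DeclaresAt start σ t') ∧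
      ∀ (p : Fin n) (x : Fin r), ∃ k ≤ t, σ k = (p, x)

end Strategy

end Prisoners

/-! A winning strategy is silent as long as some visit is missing. So a visit is silent in the real
prison whenever the visitor's history and finding also occur in an imagined prison whose schedule
misses a visit. The warden keeps such imagined prisons available forever. Moving the prisoners in
two blocks leaves two agents, and `exists_fair_sequence` joins silent finite paths into a valid
schedule.

In `Machine.exists_progress` the imagined prison has the real states and switch counts, but its room
`x` was never entered. Visits to a position held by two rooms can be copied outside `x`. If position
`c` is held by one room only, an agent led repeatedly into a room in position `!c` first creates a
second `c`, unless both agents are stubborn on `!c`.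

In that case `exists_progress_of_stubborn` gives each agent an imagined prison of his own, in which
the other's state is frozen. If one of these can become constantly `!c` with its agent stubborn,
nothing changes any more (`exists_progress_of_constant`). Otherwise an agent whose own prison has no
`c` can be made to create one, and this unblocks every visit. -/

namespace Prisoners

/-! ### Silent finite paths and fair infinite schedules -/

section Paths

variable {W M : Type*}

/-- Every move of the list `L`, played from `w`, satisfies `ok`. -/
def OkPath (step : W → M → W) (ok : W → M → Prop) : W → List M → Prop
  | _, [] => True
  | w, m :: L => ok w m ∧ OkPath step ok (step w m) L

variable {step : W → M → W} {ok : W → M → Prop}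

@[simp] lemma okPath_nil (w : W) : OkPath step ok w [] := trivial

@[simp] lemma okPath_cons (w : W) (m : M) (L : List M) :
    OkPath step ok w (m :: L) ↔ ok w m ∧ OkPath step ok (step w m) L := Iff.rfl

lemma okPath_append (w : W) (L L' : List M) :
    OkPath step ok w (L ++ L') ↔ OkPath step ok w L ∧ OkPath step ok (L.foldl step w) L' := by
  induction L generalizing w with
  | nil => simp
  | cons m L ih => simp [ih, and_assoc]

lemma exists_frequently_eq [Countable M] [Nonempty M] :
    ∃ e : ℕ → M, ∀ m, ∃ᶠ k in atTop, e k = m := by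
  obtain ⟨f, hf⟩ := exists_surjective_nat M
  refine ⟨fun k => f k.unpair.1, fun m => frequently_atTop.2 fun N => ?_⟩
  obtain ⟨i, hi⟩ := hf m
  exact ⟨Nat.pair i N, Nat.right_le_pair i N, by simp [hi]⟩

/-- If from every good world every move can be made by a good finite path, then there is an
infinite path on which every move is made infinitely often. -/
theorem exists_fair_sequence [Countable M] [Nonempty M] {Good : W → Prop}
    (progress : ∀ w, Good w → ∀ m, ∃ L, m ∈ L ∧ OkPath step ok w L ∧ Good (L.foldl step w))
    {w₀ : W} (h₀ : Good w₀) :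
    ∃ σ : ℕ → M, (∀ m, ∃ᶠ t in atTop, σ t = m) ∧
      ∀ T, OkPath step ok w₀ ((List.range T).map σ) := by
  obtain ⟨e, he⟩ := exists_frequently_eq (M := M)
  have next : ∀ (k : ℕ) (P : {L : List M // OkPath step ok w₀ L ∧ Good (L.foldl step w₀)}),
      ∃ P' : {L : List M // OkPath step ok w₀ L ∧ Good (L.foldl step w₀)},
        ∃ L, e k ∈ L ∧ P'.1 = P.1 ++ L := by
    rintro k ⟨P, hP, hG⟩
    obtain ⟨L, hL, hok, hG'⟩ := progress _ hG (e k)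
    exact ⟨⟨P ++ L, (okPath_append _ _ _).2 ⟨hP, hok⟩, by simpa using hG'⟩, L, hL, rfl⟩
  choose g hg using next
  let P : ℕ → {L : List M // OkPath step ok w₀ L ∧ Good (L.foldl step w₀)} :=
    fun k => Nat.rec ⟨[], trivial, h₀⟩ g k
  have hP : ∀ k, ∃ L, e k ∈ L ∧ (P (k + 1)).1 = (P k).1 ++ L := fun k => hg k (P k)
  have hpre : ∀ j k, j ≤ k → (P j).1 <+: (P k).1 := by
    intro j k h
    induction h with
    | refl => exact List.prefix_refl _
    | step _ ih =>
      obtain ⟨L, -, hL⟩ := hP _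
      exact ih.trans ⟨L, hL.symm⟩
  have hlen : ∀ k, k ≤ (P k).1.length := by
    intro k
    induction k with
    | zero => simp
    | succ k ih =>
      obtain ⟨L, hm, hL⟩ := hP k
      have := List.length_pos_of_mem hm
      rw [hL, List.length_append]
      omega
  -- Each stage adds at least one move, so stage `t + 1` already fixes entry `t`.
  let σ : ℕ → M := fun t => (P (t + 1)).1[t]'(hlen (t + 1))
  have hσ : ∀ k t (h : t < (P k).1.length), σ t = (P k).1[t] := by
    intro k t h
    rcases le_total (t + 1) k with h' | h'
    · exact (hpre _ _ h').getElem _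
    · exact ((hpre _ _ h').getElem _).symm
  refine ⟨σ, fun m => frequently_atTop.2 fun N => ?_, fun T => ?_⟩
  · obtain ⟨k, hk, rfl⟩ := frequently_atTop.1 (he m) N
    obtain ⟨L, hm, hL⟩ := hP k
    obtain ⟨i, hi, hi'⟩ := List.getElem_of_mem hm
    refine ⟨(P k).1.length + i, by have := hlen k; omega, ?_⟩
    rw [hσ (k + 1) _ (by rw [hL, List.length_append]; omega)]
    simp [hL, hi']
  · have : (List.range T).map σ = (P T).1.take T := by
      apply List.ext_getElem
      · simpa using hlen T
      · intro i h1 h2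
        simp only [List.length_map, List.length_range] at h1
        simp [hσ T i (h1.trans_le (hlen T))]
    rw [this]
    have h := (P T).2.1
    rw [← List.take_append_drop T (P T).1, okPath_append] at h
    exact h.1

end Paths

/-! ### Two agents and one switch per room -/

section TwoAgents

/-- The rooms and the two agents, when every room has one switch. -/
structure World (St : Type) (r : ℕ) where
  cfg : Fin r → Bool
  st : Bool → St

/-- Two deterministic agents, each with states in `St`. -/
structure Machine (St : Type) where
  out : Bool → St → Bool → Bool
  next : Bool → St → Bool → St
  ok : Bool → St → Bool → Prop

variable {St : Type} {r : ℕ}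

namespace Machine

variable (A : Machine St)

/-- The effect of a visit of agent `v.1` to room `v.2`. -/
def step (w : World St r) (v : Bool × Fin r) : World St r where
  cfg := Function.update w.cfg v.2 (A.out v.1 (w.st v.1) (w.cfg v.2))
  st := Function.update w.st v.1 (A.next v.1 (w.st v.1) (w.cfg v.2))

/-- The visit `v` is made without a declaration. -/
def Ok (w : World St r) (v : Bool × Fin r) : Prop := A.ok v.1 (w.st v.1) (w.cfg v.2)

/-- In state `s`, agent `p` never changes the switch as long as he finds it in position `b`. -/
def Stubborn (p b : Bool) (s : St) : Prop :=
  ∀ k, A.out p ((fun s => A.next p s b)^[k] s) b = b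

variable {A}

lemma Stubborn.out_eq {p b : Bool} {s : St} (h : A.Stubborn p b s) : A.out p s b = b := h 0

lemma Stubborn.next {p b : Bool} {s : St} (h : A.Stubborn p b s) :
    A.Stubborn p b (A.next p s b) := fun k => h (k + 1)

/-- A visit that does not change the configuration can be repeated until the switch is flipped,
when the agent is not stubborn. -/
lemma exists_path_to_flip {Inv : World St r → Prop} {q b : Bool} {x : Fin r}
    (hx : ∀ w, Inv w → w.cfg x = b)
    (hstep : ∀ w, Inv w → A.out q (w.st q) b = b → A.Ok w (q, x) ∧ Inv (A.step w (q, x)))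
    {w : World St r} (hw : Inv w) (hq : ¬ A.Stubborn q b (w.st q)) :
    ∃ L, OkPath A.step A.Ok w L ∧ Inv (L.foldl A.step w) ∧
      A.out q ((L.foldl A.step w).st q) b = !b := by
  simp only [Stubborn, not_forall] at hq
  obtain ⟨k, hk⟩ := hq
  induction k generalizing w with
  | zero => exact ⟨[], trivial, hw, Bool.eq_not.2 hk⟩
  | succ k ih =>
    by_cases h : A.out q (w.st q) b = b
    · obtain ⟨h1, h2⟩ := hstep w hw h
      obtain ⟨L, hL, hL'⟩ := ih h2 (by simpa [step, hx w hw] using hk)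
      exact ⟨(q, x) :: L, ⟨h1, hL⟩, hL'⟩
    · exact ⟨[], trivial, hw, Bool.eq_not.2 h⟩

end Machine

/-- The indicator of equality of two bits. -/
def ind (c b : Bool) : ℤ := if b = c then 1 else 0

@[simp] lemma ind_self (c : Bool) : ind c c = 1 := by simp [ind]
@[simp] lemma ind_not (c : Bool) : ind c (!c) = 0 := by simp [ind]

lemma ind_nonneg (c b : Bool) : 0 ≤ ind c b := by unfold ind; split_ifs <;> simp
lemma ind_le_one (c b : Bool) : ind c b ≤ 1 := by unfold ind; split_ifs <;> simp

/-- The number of rooms whose switch is in position `c`. -/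
def count (c : Bool) (f : Fin r → Bool) : ℤ := ∑ x, ind c (f x)

lemma count_update (c : Bool) (f : Fin r → Bool) (x : Fin r) (b : Bool) :
    count c (Function.update f x b) = count c f - ind c (f x) + ind c b := by
  have h1 := Finset.add_sum_erase Finset.univ (fun y => ind c (f y)) (Finset.mem_univ x)
  have h2 := Finset.add_sum_erase Finset.univ (fun y => ind c (Function.update f x b y))
    (Finset.mem_univ x)
  have h3 : ∑ y ∈ Finset.univ.erase x, ind c (Function.update f x b y) =
      ∑ y ∈ Finset.univ.erase x, ind c (f y) :=
    Finset.sum_congr rfl fun y hy => by rw [Function.update_of_ne (Finset.ne_of_mem_erase hy)]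
  simp only [Function.update_self] at h2
  unfold count
  linarith

lemma count_add_count_not (c : Bool) (f : Fin r → Bool) : count c f + count (!c) f = r := by
  unfold count
  rw [← Finset.sum_add_distrib]
  have : ∀ x, ind c (f x) + ind (!c) (f x) = 1 := fun x => by
    cases c <;> cases f x <;> rfl
  simp [this]

lemma count_nonneg (c : Bool) (f : Fin r → Bool) : 0 ≤ count c f :=
  Finset.sum_nonneg fun _ _ => ind_nonneg _ _

lemma count_le (c : Bool) (f : Fin r → Bool) : count c f ≤ r := by
  have := count_add_count_not c f
  have := count_nonneg (!c) f
  omega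

lemma one_le_count {c : Bool} {f : Fin r → Bool} {x : Fin r} (h : f x = c) : 1 ≤ count c f := by
  have := Finset.single_le_sum (f := fun y => ind c (f y)) (fun _ _ => ind_nonneg _ _)
    (Finset.mem_univ x)
  simp only [h, ind_self] at this
  exact this

lemma exists_of_one_le_count {c : Bool} {f : Fin r → Bool} (h : 1 ≤ count c f) :
    ∃ x, f x = c := by
  by_contra! hne
  have : count c f = 0 := Finset.sum_eq_zero fun x _ => by simp [ind, hne x]
  omega

lemma exists_ne_of_two_le_count {c : Bool} {f : Fin r → Bool} (h : 2 ≤ count c f) (x : Fin r) :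
    ∃ y, y ≠ x ∧ f y = c := by
  -- Forcing `x` to `!c` costs at most one `c`, so another room still holds it.
  obtain ⟨y, hy⟩ := exists_of_one_le_count (c := c) (f := Function.update f x (!c)) (by
    rw [count_update]; have := ind_le_one c (f x); simp; omega)
  rcases eq_or_ne y x with rfl | hne
  · simp at hy
  · exact ⟨y, hne, by rwa [Function.update_of_ne hne] at hy⟩

lemma eq_not_of_count_eq_zero {c : Bool} {f : Fin r → Bool} (h : count c f = 0) (x : Fin r) :
    f x = !c := by
  by_contra hne
  have := one_le_count (f := f) (c := c) (x := x) (by simpa using hne)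
  omega

/-! ### Progress by imagined worlds -/

namespace Machine

variable (A : Machine St)

lemma count_step (c : Bool) (w : World St r) (v : Bool × Fin r) :
    count c (A.step w v).cfg =
      count c w.cfg - ind c (w.cfg v.2) + ind c (A.out v.1 (w.st v.1) (w.cfg v.2)) :=
  count_update ..

/-- The world `w` can be reached from `w₀` without the visits in `V`. -/
def Avoids (w₀ : World St r) (V : Set (Bool × Fin r)) (w : World St r) : Prop :=
  ∃ L : List (Bool × Fin r), (∀ v ∈ L, v ∉ V) ∧ L.foldl A.step w₀ = w

/-- No agent declares as long as some visit has not been made. -/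
def Sound (w₀ : World St r) : Prop :=
  ∀ (L : List (Bool × Fin r)) (v : Bool × Fin r), v ∉ L → OkPath A.step A.Ok w₀ L

/-- From every world in `Good`, every visit can be made without leaving `Good` for good and without
a declaration. -/
def Progress (Good : World St r → Prop) : Prop :=
  ∀ w, Good w → ∀ v, ∃ L, v ∈ L ∧ OkPath A.step A.Ok w L ∧ Good (L.foldl A.step w)

variable {A} {w₀ w : World St r} {V : Set (Bool × Fin r)}

lemma Avoids.mono {V' : Set (Bool × Fin r)} (h : A.Avoids w₀ V w) (hV : V' ⊆ V) :
    A.Avoids w₀ V' w :=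
  let ⟨L, hL, e⟩ := h
  ⟨L, fun v hv hv' => hL v hv (hV hv'), e⟩

lemma Avoids.step (h : A.Avoids w₀ V w) {v : Bool × Fin r} (hv : v ∉ V) :
    A.Avoids w₀ V (A.step w v) := by
  obtain ⟨L, hL, rfl⟩ := h
  refine ⟨L ++ [v], fun u hu => ?_, by simp⟩
  rcases List.mem_append.1 hu with hu | hu
  · exact hL u hu
  · rwa [List.mem_singleton.1 hu]

lemma Avoids.ok (hs : A.Sound w₀) (h : A.Avoids w₀ V w) {u v : Bool × Fin r} (hu : u ∈ V)
    (hv : v ∉ V) : A.Ok w v := by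
  obtain ⟨L, hL, rfl⟩ := h
  have := hs (L ++ [v]) u fun h => by
    rcases List.mem_append.1 h with h | h
    · exact hL u h hu
    · exact hv (List.mem_singleton.1 h ▸ hu)
  exact ((okPath_append _ _ _).1 this).2.1

/-- A set of worlds with `Progress` that is reachable by a path missing some visit yields one that
contains the starting world. -/
lemma exists_progress_of_avoids (hs : A.Sound w₀) {Good : World St r → Prop}
    (hG : A.Progress Good) (hw : Good w) (h : A.Avoids w₀ V w) {u : Bool × Fin r} (hu : u ∈ V) :
    ∃ Good' : World St r → Prop, Good' w₀ ∧ A.Progress Good' := by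
  refine ⟨fun w => ∃ L, OkPath A.step A.Ok w L ∧ Good (L.foldl A.step w), ?_, ?_⟩
  · obtain ⟨L, hL, rfl⟩ := h
    exact ⟨L, hs L u fun h => hL u h hu, hw⟩
  · rintro w ⟨L, hL, hGL⟩ v
    obtain ⟨L', hv, hL', hG'⟩ := hG _ hGL v
    exact ⟨L ++ L', by simp [hv], (okPath_append _ _ _).2 ⟨hL, hL'⟩, [], trivial, by simpa using hG'⟩

/-- If all switches are in position `b` and both agents are stubborn on `b`, then they can be led
into all rooms forever. -/
lemma exists_progress_of_constant (hs : A.Sound w₀) (hr : 2 ≤ r) {u : Bool × Fin r} {b : Bool}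
    (h : A.Avoids w₀ {u} w) (hcfg : ∀ x, w.cfg x = b) (hst : ∀ p, A.Stubborn p b (w.st p)) :
    ∃ Good : World St r → Prop, Good w₀ ∧ A.Progress Good := by
  refine exists_progress_of_avoids hs (Good := fun w => (∀ x, w.cfg x = b) ∧ ∃ w',
    A.Avoids w₀ {u} w' ∧ (∀ x, w'.cfg x = b) ∧ w'.st = w.st ∧ ∀ p, A.Stubborn p b (w.st p))
    ?_ ⟨hcfg, w, h, hcfg, rfl, hst⟩ h rfl
  rintro w ⟨hw, w', ha, hw', e, hst⟩ ⟨p, x⟩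
  have : Nontrivial (Fin r) := Fin.nontrivial_iff_two_le.2 hr
  -- All rooms look alike, so a visit to any room is copied in `y`, away from the missing visit `u`.
  obtain ⟨y, hy⟩ := exists_ne u.2
  have hv : (p, y) ∉ ({u} : Set (Bool × Fin r)) := by
    rintro rfl
    exact hy rfl
  refine ⟨[(p, x)], by simp, ⟨?_, trivial⟩, ?_, A.step w' (p, y), ha.step hv, ?_, ?_, ?_⟩
  · simpa [Ok, hw, hw', e] using ha.ok hs rfl hv
  · intro z
    by_cases hz : z = x
    · subst hz; simp [step, hw, (hst p).out_eq]
    · simp [step, hw, hz]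
  · intro z
    by_cases hz : z = y
    · subst hz; simp [step, hw', e, (hst p).out_eq]
    · simp [step, hw', hz]
  · simp [step, hw, hw', e]
  · intro q
    by_cases hq : q = p
    · subst hq; simpa [step, hw] using (hst q).next
    · simpa [step, hq] using hst q

/-- If there is a reachable world in which nobody has been in room `x`, exactly one switch is in
position `c`, and both agents are stubborn on the other position, then the agents can be led into
all rooms forever. -/
lemma exists_progress_of_stubborn (hs : A.Sound w₀) (hr : 2 ≤ r) {x : Fin r} {c : Bool}
    (hQ : A.Avoids w₀ {v | v.2 = x} w) (hcount : count c w.cfg = 1)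
    (hst : ∀ p, A.Stubborn p (!c) (w.st p)) :
    ∃ Good : World St r → Prop, Good w₀ ∧ A.Progress Good := by
  -- Agent `p` may enter every room of his own world; the visit it misses is that of the other agent
  -- to `x`.
  let Own : Bool → St → ℤ → Prop := fun p s m => ∃ w' : World St r, A.Avoids w₀ {(!p, x)} w' ∧
    w'.st p = s ∧ w'.st (!p) = w.st (!p) ∧ count c w'.cfg = m
  by_cases H : ∀ p s, Own p s 0 → ¬ A.Stubborn p (!c) s
  swap
  · push Not at H
    obtain ⟨p, s, ⟨w', ha, rfl, h2, h3⟩, hp⟩ := H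
    refine exists_progress_of_constant hs hr ha (eq_not_of_count_eq_zero h3) fun q => ?_
    by_cases hq : q = p
    · rwa [hq]
    · obtain rfl : q = !p := by cases q <;> cases p <;> simp_all
      rw [h2]
      exact hst _
  have own_nonneg : ∀ p s m, Own p s m → 0 ≤ m := by
    rintro p s m ⟨w', -, -, -, rfl⟩
    exact count_nonneg _ _
  have own_le : ∀ p s m, Own p s m → m ≤ r := by
    rintro p s m ⟨w', -, -, -, rfl⟩
    exact count_le _ _
  -- The two bounds say exactly that the own world has a room in position `b`.
  have own_step : ∀ p s m b, Own p s m → ind c b ≤ m → m - ind c b < r →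
      A.ok p s b ∧ Own p (A.next p s b) (m - ind c b + ind c (A.out p s b)) := by
    rintro p s m b ⟨w', ha, rfl, h2, rfl⟩ h3 h4
    obtain ⟨y, rfl⟩ : ∃ y, w'.cfg y = b := by
      apply exists_of_one_le_count
      by_cases hb : b = c
      · subst hb; simpa using h3
      · obtain rfl : b = !c := by cases b <;> cases c <;> simp_all
        have := count_add_count_not c w'.cfg
        rw [ind_not] at h4
        omega
    have hv : (p, y) ∉ ({(!p, x)} : Set (Bool × Fin r)) := by simp
    exact ⟨ha.ok hs rfl hv, A.step w' (p, y), ha.step hv, by simp [step], by simp [step, h2],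
      A.count_step _ _ _⟩
  -- Both own counts start at 1, as does the real one, and the real count accumulates the changes
  -- made by both agents.
  let Good : World St r → (Bool → ℤ) → Prop := fun w m =>
    (∀ p, Own p (w.st p) (m p)) ∧ ∀ p, count c w.cfg = m p + m (!p) - 1
  have good_step : ∀ w m p y, Good w m → ind c (w.cfg y) ≤ m p → m p - ind c (w.cfg y) < r →
      A.Ok w (p, y) ∧ Good (A.step w (p, y)) (Function.update m p
        (m p - ind c (w.cfg y) + ind c (A.out p (w.st p) (w.cfg y)))) := by
    rintro w m p y ⟨h1, h2⟩ h3 h4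
    obtain ⟨h5, h6⟩ := own_step _ _ _ _ (h1 p) h3 h4
    refine ⟨h5, fun q => ?_, fun q => ?_⟩
    · by_cases hq : q = p
      · subst hq; simpa [step] using h6
      · simpa [step, hq] using h1 q
    · rw [A.count_step, h2 p]
      by_cases hq : q = p
      · subst hq; simp; ring
      · obtain rfl : q = !p := by cases q <;> cases p <;> simp_all
        simp; ring
  refine exists_progress_of_avoids hs (Good := fun w => ∃ m, Good w m) ?_
    ⟨fun _ => 1, fun p => ⟨w, hQ.mono (by simp), rfl, rfl, hcount⟩, fun _ => by simp [hcount]⟩ hQ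
    (u := (true, x)) rfl
  rintro w ⟨m, hm⟩ ⟨p, y⟩
  have flip : ∀ q x, w.cfg x = (!c) → m q = 0 → ∃ L, OkPath A.step A.Ok w L ∧
      (L.foldl A.step w).cfg = Function.update w.cfg x c ∧
      Good (L.foldl A.step w) (Function.update m q 1) := by
    intro q x hx hmq
    obtain ⟨L, hL, ⟨hcfg, hG⟩, hout⟩ := exists_path_to_flip (A := A) (q := q) (b := !c) (x := x)
      (Inv := fun w' => w'.cfg = w.cfg ∧ Good w' m) (w := w) (by rintro w' ⟨h, -⟩; rwa [h])
      (by
        rintro w' ⟨h, hG⟩ ho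
        have hx' : w'.cfg x = !c := by rwa [h]
        obtain ⟨h1, h2⟩ := good_step w' m q x hG (by simp [hx', hmq]) (by simp [hx', hmq]; omega)
        refine ⟨h1, ?_, ?_⟩
        · dsimp only [step]
          rw [hx', ho, ← hx', Function.update_eq_self, h]
        · simpa [hx', ho] using h2)
      ⟨rfl, hm⟩ (H q _ (hmq ▸ hm.1 q))
    set w' := L.foldl A.step w with hw'
    have hx' : w'.cfg x = !c := by rwa [hcfg]
    obtain ⟨h1, h2⟩ := good_step w' m q x hG (by simp [hx', hmq]) (by simp [hx', hmq]; omega)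
    refine ⟨L ++ [(q, x)], (okPath_append _ _ _).2 ⟨hL, h1, trivial⟩, ?_, ?_⟩
    · rw [List.foldl_append, ← hw']
      simp only [List.foldl_cons, List.foldl_nil, step, hx', hout, hcfg, Bool.not_not]
    · rw [List.foldl_append, ← hw']
      simpa [hx', hout, hmq] using h2
  have finish : ∀ L m', OkPath A.step A.Ok w L → Good (L.foldl A.step w) m' →
      ind c ((L.foldl A.step w).cfg y) ≤ m' p → m' p - ind c ((L.foldl A.step w).cfg y) < r →
      ∃ L, (p, y) ∈ L ∧ OkPath A.step A.Ok w L ∧ ∃ m, Good (L.foldl A.step w) m := by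
    intro L m' hL hG h1 h2
    obtain ⟨h3, h4⟩ := good_step _ m' p y hG h1 h2
    exact ⟨L ++ [(p, y)], by simp, (okPath_append _ _ _).2 ⟨hL, h3, trivial⟩, _, by
      rw [List.foldl_append]; exact h4⟩
  have hp0 := own_nonneg _ _ _ (hm.1 p)
  have hp1 := own_le _ _ _ (hm.1 p)
  have hq0 := own_nonneg _ _ _ (hm.1 !p)
  have hq1 := own_le _ _ _ (hm.1 !p)
  have hsum := hm.2 p
  have hnot := count_add_count_not c w.cfg
  by_cases hy : w.cfg y = c
  · rcases hp0.eq_or_lt with h | h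
    -- The own world of `p` lacks `c`. The real count is `m (!p) - 1 < r`, so `p` can be made to
    -- flip some room to `c` first.
    · obtain ⟨z, hz⟩ : ∃ z, w.cfg z = !c := exists_of_one_le_count (by omega)
      obtain ⟨L, hL, hcfg, hG⟩ := flip p z hz h.symm
      have hyz : y ≠ z := by
        rintro rfl
        simp [hy] at hz
      refine finish L _ hL hG ?_ ?_ <;> simp [hcfg, hyz, hy]
      omega
    · refine finish [] m trivial hm ?_ ?_ <;> simp [hy] <;> omega
  · have hy' : w.cfg y = !c := Bool.eq_not.2 hy
    rcases hp1.eq_or_lt with h | h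
    -- The own world of `p` lacks `!c`. As `y` is not in position `c`, the real count is below `r`,
    -- which forces `m (!p) = 0`: the other agent can be made to flip `y`.
    · have := one_le_count hy'
      obtain ⟨L, hL, hcfg, hG⟩ := flip (!p) y hy' (by omega)
      refine finish L _ hL hG ?_ ?_ <;> simp [hcfg] <;> omega
    · refine finish [] m trivial hm ?_ ?_ <;> simp [hy'] <;> omega

/-- Two agents whose declarations are sound can be led into all rooms forever without a
declaration. -/
theorem exists_progress (hs : A.Sound w₀) (hr : 3 ≤ r) :
    ∃ Good : World St r → Prop, Good w₀ ∧ A.Progress Good := by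
  let Alt : World St r → Prop := fun w => ∃ w' x, A.Avoids w₀ {v | v.2 = x} w' ∧
    w'.st = w.st ∧ ∀ c, count c w'.cfg = count c w.cfg
  by_cases H : ∃ w c, Alt w ∧ count c w.cfg = 1 ∧ ∀ p, A.Stubborn p (!c) (w.st p)
  · obtain ⟨w, c, ⟨w', x, ha, e, hc⟩, h1, h2⟩ := H
    exact exists_progress_of_stubborn hs (by omega) ha ((hc c).trans h1) (by rwa [e])
  push Not at H
  have alt_step : ∀ w v, Alt w → 2 ≤ count (w.cfg v.2) w.cfg → A.Ok w v ∧ Alt (A.step w v) := by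
    rintro w ⟨p, y⟩ ⟨w', x, ha, e, hc⟩ h2
    obtain ⟨z, hz, hz'⟩ := exists_ne_of_two_le_count ((hc _).symm ▸ h2) x
    have hv : (p, z) ∉ {v : Bool × Fin r | v.2 = x} := hz
    refine ⟨?_, A.step w' (p, z), x, ha.step hv, ?_, fun c => ?_⟩
    · simpa [Ok, e, hz'] using ha.ok hs (u := (p, x)) rfl hv
    · simp [step, e, hz']
    · rw [A.count_step, A.count_step, hc, e, hz']
  refine ⟨Alt, ⟨w₀, ⟨0, by omega⟩, ⟨[], by simp, rfl⟩, rfl, fun _ => rfl⟩, ?_⟩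
  rintro w hw ⟨p, y⟩
  by_cases h2 : 2 ≤ count (w.cfg y) w.cfg
  · obtain ⟨h3, h4⟩ := alt_step w (p, y) hw h2
    exact ⟨[(p, y)], by simp, ⟨h3, trivial⟩, h4⟩
  generalize hc : w.cfg y = c at h2
  have h1 : count c w.cfg = 1 := le_antisymm (by omega) (one_le_count hc)
  obtain ⟨q, hq⟩ := H w c hw h1
  have hnot := count_add_count_not c w.cfg
  -- With three rooms, at least two are in position `!c`, so visits to `x` can be copied; after the
  -- flip two rooms hold `c`, and so can the visit to `y`.
  obtain ⟨x, hx⟩ : ∃ x, w.cfg x = !c := exists_of_one_le_count (by omega)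
  have hyx : y ≠ x := by
    rintro rfl
    simp [hc] at hx
  obtain ⟨L, hL, ⟨hcfg, hA⟩, hout⟩ := exists_path_to_flip (A := A) (q := q) (b := !c) (x := x)
    (Inv := fun w' => w'.cfg = w.cfg ∧ Alt w') (w := w) (by rintro w' ⟨h, -⟩; rwa [h])
    (by
      rintro w' ⟨h, hA⟩ ho
      have hx' : w'.cfg x = !c := by rwa [h]
      obtain ⟨h1, h2⟩ := alt_step w' (q, x) hA (by simp only [h, hx]; omega)
      refine ⟨h1, ?_, h2⟩
      dsimp only [step]
      rw [hx', ho, ← hx', Function.update_eq_self, h])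
    ⟨rfl, hw⟩ hq
  set w' := L.foldl A.step w with hw'
  obtain ⟨h3, h4⟩ := alt_step w' (q, x) hA (by simp only [hcfg, hx]; omega)
  have hy' : (A.step w' (q, x)).cfg y = c := by simp [step, hyx, hcfg, hc]
  obtain ⟨h5, h6⟩ := alt_step (A.step w' (q, x)) (p, y) h4 (by
    simp [hy', A.count_step, hcfg, hx, hout, h1])
  refine ⟨L ++ [(q, x), (p, y)], by simp, (okPath_append _ _ _).2 ⟨hL, h3, h5, trivial⟩, ?_⟩
  rw [List.foldl_append]
  exact h6

end Machine

end TwoAgents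

/-! ### From prisoners to two agents -/

namespace Strategy

variable {n r : ℕ} (S : Strategy n 1)

/-- The visit `v` is made without a declaration. -/
def Ok (w : State n r 1) (v : Fin n × Fin r) : Prop :=
  ¬ S.declares v.1 (w.seen v.1) (w.config v.2)

lemma stateAt_eq_foldl (start : Fin r → Config 1) (σ : Schedule n r) (T : ℕ) :
    S.stateAt start σ T = ((List.range T).map σ).foldl S.step ⟨start, fun _ => []⟩ := by
  induction T with
  | zero => rfl
  | succ T ih => simp [List.range_succ, stateAt, ih]

lemma okPath_map_range_iff (start : Fin r → Config 1) (σ : Schedule n r) (T : ℕ) :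
    OkPath S.step S.Ok ⟨start, fun _ => []⟩ ((List.range T).map σ) ↔
      ∀ t < T, ¬ S.DeclaresAt start σ t := by
  induction T with
  | zero => simp
  | succ T ih =>
    rw [List.range_succ, List.map_append, okPath_append, ih, ← stateAt_eq_foldl]
    simp only [List.map_cons, List.map_nil, okPath_cons, okPath_nil, and_true,
      Nat.forall_lt_succ_right]
    rfl

variable {S}

/-- A winning strategy makes no declaration before all visits have been made. -/
lemma IsWinning.okPath {start : Fin r → Config 1} (h : S.IsWinning start)
    (L : List (Fin n × Fin r)) (v : Fin n × Fin r) (hv : v ∉ L) :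
    OkPath S.step S.Ok ⟨start, fun _ => []⟩ L := by
  have : Nonempty (Fin n × Fin r) := ⟨v⟩
  obtain ⟨e, he⟩ := exists_frequently_eq (M := Fin n × Fin r)
  -- Any finite path extends to a valid schedule, on which `v` first occurs after `L`; the first
  -- declaration cannot come earlier.
  let σ : Schedule n r := fun t => if h : t < L.length then L[t] else e t
  have hσ : (List.range L.length).map σ = L := by
    apply List.ext_getElem
    · simp
    · intro i h1 h2
      simp [σ, h2]
  obtain ⟨t, -, ht, hall⟩ := h σ fun p x => by
    refine ((he (p, x)).and_eventually (eventually_ge_atTop L.length)).mono ?_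
    rintro t ⟨h1, h2⟩
    simpa [σ, h2.not_gt] using h1
  obtain ⟨k, hk, hk'⟩ := hall v.1 v.2
  rw [← hσ, okPath_map_range_iff]
  intro i hi
  refine ht i (hi.trans_le (le_trans ?_ hk))
  by_contra! hlt
  apply hv
  have : σ k = v := hk'
  rw [← this]
  simp [σ, hlt]

/-- Under a winning strategy no invariant set of states lets all visits be made forever without a
declaration. -/
lemma IsWinning.not_progress {start : Fin r → Config 1} (h : S.IsWinning start)
    [Nonempty (Fin n × Fin r)] {Good : State n r 1 → Prop} (h₀ : Good ⟨start, fun _ => []⟩)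
    (progress : ∀ w, Good w → ∀ v, ∃ L, v ∈ L ∧ OkPath S.step S.Ok w L ∧ Good (L.foldl S.step w)) :
    False := by
  obtain ⟨σ, hσ, hok⟩ := exists_fair_sequence progress h₀
  obtain ⟨t, ht, -⟩ := h σ fun p x => hσ (p, x)
  exact (S.okPath_map_range_iff start σ (t + 1)).1 (hok _) t t.lt_succ_self ht

variable (S)

/-- The effect of a visit of prisoner `q` to a fixed room in configuration `z.2`, on the
configuration and on what the prisoners have seen. -/
def visit (z : (Fin n → List (Config 1)) × Config 1) (q : Fin n) :
    (Fin n → List (Config 1)) × Config 1 :=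
  (Function.update z.1 q (z.2 :: z.1 q), S.reconfigure q (z.1 q) z.2)

/-- Prisoner `q` visits a fixed room without declaring. -/
def VisitOk (z : (Fin n → List (Config 1)) × Config 1) (q : Fin n) : Prop :=
  ¬ S.declares q (z.1 q) z.2

lemma foldl_step_map (w : State n r 1) (x : Fin r) (l : List (Fin n)) :
    (l.map (·, x)).foldl S.step w =
      ⟨Function.update w.config x (l.foldl S.visit (w.seen, w.config x)).2,
        (l.foldl S.visit (w.seen, w.config x)).1⟩ := by
  induction l generalizing w with
  | nil => simp
  | cons q l ih =>
    simp only [List.map_cons, List.foldl_cons, ih]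
    simp [step, visit]

lemma okPath_map_iff (w : State n r 1) (x : Fin r) (l : List (Fin n)) :
    OkPath S.step S.Ok w (l.map (·, x)) ↔ OkPath S.visit S.VisitOk (w.seen, w.config x) l := by
  induction l generalizing w with
  | nil => simp
  | cons q l ih =>
    simp only [List.map_cons, okPath_cons, ih]
    simp [step, visit, Ok, VisitOk]

/-- The group of a prisoner: the first prisoner is alone in his group. -/
def side (q : Fin n) : Bool := decide (q.val = 0)

/-- The prisoners of a group. -/
def group (n : ℕ) (p : Bool) : List (Fin n) := (List.finRange n).filter fun q => side q == p

@[simp] lemma mem_group {p : Bool} {q : Fin n} : q ∈ group n p ↔ side q = p := by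
  simp [group]

lemma exists_mem_group (hn : 2 ≤ n) (p : Bool) : ∃ q, q ∈ group n p := by
  cases p
  · exact ⟨⟨1, by omega⟩, by simp [side]⟩
  · exact ⟨⟨0, by omega⟩, by simp [side]⟩

/-- What the prisoners of group `p` have seen. -/
def mask (p : Bool) (s : Fin n → List (Config 1)) : Fin n → List (Config 1) :=
  fun q => if side q = p then s q else []

/-- A prisoner reads and extends only his own history, so hiding the other group changes nothing. -/
lemma mask_visit {q : Fin n} (s : Fin n → List (Config 1)) (c : Config 1) :
    S.visit (mask (side q) s, c) q = (mask (side q) (S.visit (s, c) q).1, (S.visit (s, c) q).2) := by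
  refine Prod.ext (funext fun q' => ?_) (by simp [visit, mask])
  by_cases h : q' = q
  · subst h; simp [visit, mask]
  · simp [visit, mask, h]

lemma mask_visit_of_ne {q : Fin n} {p : Bool} (h : side q ≠ p)
    (z : (Fin n → List (Config 1)) × Config 1) : mask p (S.visit z q).1 = mask p z.1 := by
  funext q'
  by_cases h' : q' = q
  · subst h'; simp [mask, h]
  · simp [visit, mask, h']

lemma foldl_visit_mask {p : Bool} {l : List (Fin n)} (hl : ∀ q ∈ l, side q = p)
    (z : (Fin n → List (Config 1)) × Config 1) :
    l.foldl S.visit (mask p z.1, z.2) =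
      (mask p (l.foldl S.visit z).1, (l.foldl S.visit z).2) := by
  induction l generalizing z with
  | nil => rfl
  | cons q l ih =>
    obtain ⟨rfl, hl⟩ := List.forall_mem_cons.1 hl
    simp only [List.foldl_cons, mask_visit, ih hl]

lemma okPath_visit_mask {p : Bool} {l : List (Fin n)} (hl : ∀ q ∈ l, side q = p)
    (z : (Fin n → List (Config 1)) × Config 1) :
    OkPath S.visit S.VisitOk (mask p z.1, z.2) l ↔ OkPath S.visit S.VisitOk z l := by
  induction l generalizing z with
  | nil => rfl
  | cons q l ih =>
    obtain ⟨rfl, hl⟩ := List.forall_mem_cons.1 hl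
    simp only [okPath_cons, mask_visit, ih hl]
    simp [VisitOk, mask]

lemma mask_foldl_visit_of_ne {p : Bool} {l : List (Fin n)} (hl : ∀ q ∈ l, side q ≠ p)
    (z : (Fin n → List (Config 1)) × Config 1) :
    mask p (l.foldl S.visit z).1 = mask p z.1 := by
  induction l generalizing z with
  | nil => rfl
  | cons q l ih =>
    obtain ⟨hq, hl⟩ := List.forall_mem_cons.1 hl
    rw [List.foldl_cons, ih hl, S.mask_visit_of_ne hq]

/-- The two groups as agents: on a visit of an agent, all the prisoners of the group visit the room
one after the other. -/
def machine : Machine (Fin n → List (Config 1)) where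
  out p s b := ((group n p).foldl S.visit (s, fun _ => b)).2 0
  next p s b := ((group n p).foldl S.visit (s, fun _ => b)).1
  ok p s b := OkPath S.visit S.VisitOk (s, fun _ => b) (group n p)

/-- The world of the two groups that belongs to a state of the prison. -/
def world (w : State n r 1) : World (Fin n → List (Config 1)) r where
  cfg x := w.config x 0
  st p := mask p w.seen

/-- The visits of the single prisoners that make up a visit of a group. -/
def block (v : Bool × Fin r) : List (Fin n × Fin r) := (group n v.1).map (·, v.2)

lemma config_eq (c : Config 1) : (fun _ => c 0) = c :=
  funext fun i => by rw [Subsingleton.elim i 0]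

lemma world_foldl_block (w : State n r 1) (v : Bool × Fin r) :
    world ((block v).foldl S.step w) = S.machine.step (world w) v := by
  obtain ⟨p, x⟩ := v
  have hl : ∀ q ∈ group n p, side q = p := fun q hq => mem_group.1 hq
  have key := S.foldl_visit_mask hl (w.seen, w.config x)
  simp only [block, foldl_step_map, world, Machine.step, machine, config_eq, key,
    World.mk.injEq]
  constructor
  · funext y
    by_cases hy : y = x
    · subst hy; simp
    · simp [hy]
  · funext p'
    by_cases hp : p' = p
    · subst hp; simp
    · rw [Function.update_of_ne hp]
      exact S.mask_foldl_visit_of_ne (fun q hq h => hp (h.symm.trans (hl q hq))) _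

lemma okPath_block_iff (w : State n r 1) (v : Bool × Fin r) :
    OkPath S.step S.Ok w (block v) ↔ S.machine.Ok (world w) v := by
  rw [block, okPath_map_iff, ← S.okPath_visit_mask fun q hq => mem_group.1 hq]
  simp only [Machine.Ok, machine, world, config_eq]

lemma world_foldl_flatMap (w : State n r 1) (L : List (Bool × Fin r)) :
    world ((L.flatMap block).foldl S.step w) = L.foldl S.machine.step (world w) := by
  induction L generalizing w with
  | nil => rfl
  | cons v L ih => rw [List.flatMap_cons, List.foldl_append, ih, world_foldl_block, List.foldl_cons]

lemma okPath_flatMap_iff (w : State n r 1) (L : List (Bool × Fin r)) :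
    OkPath S.step S.Ok w (L.flatMap block) ↔
      OkPath S.machine.step S.machine.Ok (world w) L := by
  induction L generalizing w with
  | nil => simp
  | cons v L ih =>
    rw [List.flatMap_cons, okPath_append, ih, world_foldl_block, okPath_block_iff, okPath_cons]

lemma mem_flatMap_block {L : List (Bool × Fin r)} {q : Fin n} {x : Fin r} :
    (q, x) ∈ L.flatMap block ↔ (side q, x) ∈ L := by
  simp [block]

/-- Both groups are nonempty, so a missing visit of a group is a missing visit of some prisoner. -/
lemma IsWinning.sound {S : Strategy n 1} (hn : 2 ≤ n) {start : Fin r → Config 1}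
    (h : S.IsWinning start) : S.machine.Sound (world ⟨start, fun _ => []⟩) := by
  rintro L ⟨p, x⟩ hv
  obtain ⟨q, hq⟩ := exists_mem_group hn p
  rw [← okPath_flatMap_iff]
  refine h.okPath _ (q, x) ?_
  rwa [mem_flatMap_block, mem_group.1 hq]

end Strategy

end Prisoners

/-- With one switch per room, at least two prisoners and at least five rooms, no strategy wins,
whatever the (known) starting configurations of the rooms are; in particular none wins when every
switch starts off. -/
theorem mainTheorem3 (n r : ℕ) (hn : 2 ≤ n) (hr : 5 ≤ r)
    (start : Fin r → Prisoners.Config 1) :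
    ¬ ∃ S : Prisoners.Strategy n 1, S.IsWinning start := by
  rintro ⟨S, hS⟩
  obtain ⟨Good, h₀, hG⟩ := Prisoners.Machine.exists_progress (hS.sound hn) (by omega)
  have : Nonempty (Fin n × Fin r) := ⟨⟨0, by omega⟩, ⟨0, by omega⟩⟩
  refine hS.not_progress (Good := fun w => Good (Prisoners.Strategy.world w)) h₀ ?_
  rintro w hw ⟨q, x⟩
  obtain ⟨L, hv, hL, hG'⟩ := hG _ hw (Prisoners.Strategy.side q, x)
  exact ⟨L.flatMap Prisoners.Strategy.block, Prisoners.Strategy.mem_flatMap_block.2 hv,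
    (S.okPath_flatMap_iff w L).2 hL, by rwa [S.world_foldl_flatMap]⟩
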